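/- For $\nu\in\mathbb{R}$ and $x>0$, let $$\mathbf{L}_\nu(x)=\sum_{k=0}^\infty \frac{(x/2)^{\nu+2k+1}}{\Gamma(k+\frac32)\,\Gamma(k+\nu+\frac32)}$$ denote the modified Struve function of the first kind, where $1/\Gamma$ is taken to be $0$ at the poles of $\Gamma$. Let $\nu>0$. Then, for all $x>0$, $$\frac{\mathbf{L}_{\nu}(x)}{\mathbf{L}_{\nu-1}(x)}>\frac{x}{2\nu+1+x}.$$ This bound is tight in the limits $x\downarrow 0$ and $x\to\infty$, that is, the quotient of its two sides tends to $1$: $$\lim_{x\downarrow 0}\frac{\mathbf{L}_{\nu}(x)/\mathbf{L}_{\nu-1}(x)}{x/(2\nu+1+x)}=1\quad\text{and}\quad \lim_{x\to\infty}\frac{\mathbf{L}_{\nu}(x)/\mathbf{L}_{\nu-1}(x)}{x/(2\nu+1+x)}=1.$$ -/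

import Mathlib

open Filter Topology

/-- The modified Struve function of the first kind, given by its power series
`∑ (x/2)^(ν+2k+1) / (Γ(k+3/2) Γ(k+ν+3/2))`, for a real order `ν` and an argument `x > 0`
(where `1/Γ` vanishes at the poles of `Γ`). -/
noncomputable def struveL (ν x : ℝ) : ℝ :=
  ∑' k : ℕ, (x / 2) ^ (ν + 2 * (k : ℝ) + 1) /
    (Real.Gamma ((k : ℝ) + 3 / 2) * Real.Gamma ((k : ℝ) + ν + 3 / 2))

/-!
Put `t = x / 2` and `w k = t ^ (2k) / (Γ(k + 3/2) Γ(k + ν + 3/2))`, and read the `w k` as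
unnormalised weights on `ℕ`, of total mass `S₀ = ∑ w k` and first moment `S₁ = ∑ k w k`. Since
`Γ(k + ν + 3/2) = (k + ν + 1/2) Γ(k + ν + 1/2)`,
`L_ν(x) / L_{ν-1}(x) = t S₀ / ((ν + 1/2) S₀ + S₁)` (`struveL_div_struveL`), and both the bound and
its tightness are statements about the mean `S₁ / S₀`:

* the bound is equivalent to `S₁ < t S₀` (`tsum_mul_struveWeight_lt`). This follows by summing
  `2 t (k + 1) w (k + 1) ≤ t² w k + t² w (k + 1)`, which is the inequality of arithmetic and
  geometric means combined with the recurrence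
  `(k + 3/2) (k + ν + 3/2) w (k + 1) = t² w k`;
* the limit at `0` needs only `S₁ ≥ 0`, which bounds the quotient by `(2ν + 1 + x) / (2ν + 1)`;
* the limit at infinity needs `S₁ ≥ (t - ν - 5/4) S₀` for `t ≥ 1`
  (`le_tsum_mul_struveWeight`), which bounds the quotient by `(2ν + 1 + x) / (x - 3/2)`. The
  recurrence expresses the moments of `(k + 1/2) (k + ν + 1/2)` and of
  `k (k + 1/2) (k + ν + 1/2)` through `S₀` and `S₁`, and the expectation of `k (k - t)² ≥ 0` turns
  these into a lower bound for `S₁`.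
-/

/-! ### The weights and their moments -/

/-- The `k`-th term of the power series of `L_ν(2t)`, divided by the factor `t ^ (ν + 1)`. -/
noncomputable def struveWeight (ν t : ℝ) (k : ℕ) : ℝ :=
  t ^ (2 * k) / (Real.Gamma ((k : ℝ) + 3 / 2) * Real.Gamma ((k : ℝ) + ν + 3 / 2))

section Weights

variable {ν t : ℝ}

lemma struveWeight_pos (hν : 0 < ν) (ht : 0 < t) (k : ℕ) : 0 < struveWeight ν t k := by
  have h1 : 0 < Real.Gamma ((k : ℝ) + 3 / 2) := Real.Gamma_pos_of_pos (by positivity)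
  have h2 : 0 < Real.Gamma ((k : ℝ) + ν + 3 / 2) := Real.Gamma_pos_of_pos (by positivity)
  unfold struveWeight
  positivity

lemma struveWeight_succ (hν : 0 < ν) (k : ℕ) :
    ((k : ℝ) + 3 / 2) * ((k : ℝ) + ν + 3 / 2) * struveWeight ν t (k + 1) =
      t ^ 2 * struveWeight ν t k := by
  have e1 : Real.Gamma (((k + 1 : ℕ) : ℝ) + 3 / 2) =
      ((k : ℝ) + 3 / 2) * Real.Gamma ((k : ℝ) + 3 / 2) := by
    rw [← Real.Gamma_add_one (by positivity)]
    congr 1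
    push_cast
    ring
  have e2 : Real.Gamma (((k + 1 : ℕ) : ℝ) + ν + 3 / 2) =
      ((k : ℝ) + ν + 3 / 2) * Real.Gamma ((k : ℝ) + ν + 3 / 2) := by
    rw [← Real.Gamma_add_one (by positivity)]
    congr 1
    push_cast
    ring
  have h1 : 0 < Real.Gamma ((k : ℝ) + 3 / 2) := Real.Gamma_pos_of_pos (by positivity)
  have h2 : 0 < Real.Gamma ((k : ℝ) + ν + 3 / 2) := Real.Gamma_pos_of_pos (by positivity)
  have h3 : (0 : ℝ) < (k : ℝ) + 3 / 2 := by positivity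
  have h4 : (0 : ℝ) < (k : ℝ) + ν + 3 / 2 := by positivity
  unfold struveWeight
  rw [e1, e2]
  field_simp
  ring

lemma summable_struveWeight (hν : 0 < ν) (ht : 0 < t) : Summable (struveWeight ν t) := by
  refine summable_of_ratio_norm_eventually_le (r := 1 / 2) (by norm_num) ?_
  filter_upwards [eventually_ge_atTop ⌈2 * t ^ 2⌉₊] with k hk
  have hk' : 2 * t ^ 2 ≤ (k : ℝ) := Nat.ceil_le.mp hk
  have hk0 : (0 : ℝ) ≤ k := k.cast_nonneg
  have hw := struveWeight_pos hν ht (k + 1)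
  rw [Real.norm_of_nonneg hw.le, Real.norm_of_nonneg (struveWeight_pos hν ht k).le]
  have hG : 2 * t ^ 2 ≤ ((k : ℝ) + 3 / 2) * ((k : ℝ) + ν + 3 / 2) := by
    nlinarith [mul_nonneg hk0 hk0, mul_nonneg hk0 hν.le]
  have h := mul_le_mul_of_nonneg_right hG hw.le
  rw [struveWeight_succ hν] at h
  have ht2 : 0 < t ^ 2 := by positivity
  refine le_of_mul_le_mul_left ?_ ht2
  linarith

lemma summable_quadratic_mul_struveWeight (hν : 0 < ν) (ht : 0 < t) :
    Summable fun k : ℕ => ((k : ℝ) + 1 / 2) * ((k : ℝ) + ν + 1 / 2) * struveWeight ν t k := by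
  rw [← summable_nat_add_iff 1]
  refine ((summable_struveWeight hν ht).mul_left (t ^ 2)).congr fun k => ?_
  rw [← struveWeight_succ hν]
  push_cast
  ring

lemma summable_mul_struveWeight (hν : 0 < ν) (ht : 0 < t) :
    Summable fun k : ℕ => (k : ℝ) * struveWeight ν t k := by
  refine Summable.of_nonneg_of_le
    (fun k => mul_nonneg k.cast_nonneg (struveWeight_pos hν ht k).le) (fun k => ?_)
    (summable_quadratic_mul_struveWeight hν ht)
  have hk0 : (0 : ℝ) ≤ k := k.cast_nonneg
  refine mul_le_mul_of_nonneg_right ?_ (struveWeight_pos hν ht k).le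
  nlinarith [sq_nonneg ((k : ℝ) - 1 / 2), mul_nonneg hk0 hν.le]

lemma tsum_struveWeight_pos (hν : 0 < ν) (ht : 0 < t) : 0 < ∑' k, struveWeight ν t k :=
  (summable_struveWeight hν ht).tsum_pos (fun k => (struveWeight_pos hν ht k).le) 0
    (struveWeight_pos hν ht 0)

lemma tsum_mul_struveWeight_nonneg (hν : 0 < ν) (ht : 0 < t) :
    0 ≤ ∑' k : ℕ, (k : ℝ) * struveWeight ν t k :=
  tsum_nonneg fun k => mul_nonneg k.cast_nonneg (struveWeight_pos hν ht k).le

/-- The mean of `k` under the weights is less than `t`. -/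
lemma tsum_mul_struveWeight_lt (hν : 0 < ν) (ht : 0 < t) :
    ∑' k : ℕ, (k : ℝ) * struveWeight ν t k < t * ∑' k, struveWeight ν t k := by
  have hs0 := summable_struveWeight hν ht
  have hs1 := summable_mul_struveWeight hν ht
  have e0 := hs0.tsum_eq_zero_add
  have e1 := hs1.tsum_eq_zero_add
  have hs0' := (summable_nat_add_iff 1).mpr hs0
  have hs1' := (summable_nat_add_iff 1).mpr hs1
  have key : ∀ k : ℕ, 2 * t * (((k + 1 : ℕ) : ℝ) * struveWeight ν t (k + 1)) ≤
      t ^ 2 * struveWeight ν t k + t ^ 2 * struveWeight ν t (k + 1) := by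
    intro k
    rw [← struveWeight_succ hν, ← add_mul, ← mul_assoc]
    refine mul_le_mul_of_nonneg_right ?_ (struveWeight_pos hν ht (k + 1)).le
    have hk0 : (0 : ℝ) ≤ k := k.cast_nonneg
    push_cast
    nlinarith [sq_nonneg ((k : ℝ) + 1 - t), mul_nonneg hk0 hν.le]
  have h := (hs1'.mul_left (2 * t)).tsum_le_tsum key
    ((hs0.mul_left (t ^ 2)).add (hs0'.mul_left (t ^ 2)))
  rw [(hs0.mul_left (t ^ 2)).tsum_add (hs0'.mul_left (t ^ 2)), tsum_mul_left, tsum_mul_left,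
    tsum_mul_left] at h
  simp only [Nat.cast_zero, zero_mul, zero_add] at e1
  rw [← e1] at h
  have hw := mul_pos (pow_pos ht 2) (struveWeight_pos hν ht 0)
  refine lt_of_mul_lt_mul_left ?_ (by positivity : 0 ≤ 2 * t)
  have e0' := congrArg (fun y => t ^ 2 * y) e0
  simp only [mul_add] at e0'
  linarith

/-- The mean of `k` under the weights is at least `t - O(1)` as `t → ∞`. -/
lemma le_tsum_mul_struveWeight (hν : 0 < ν) (ht : 1 ≤ t) :
    (t - ν - 5 / 4) * ∑' k, struveWeight ν t k ≤ ∑' k : ℕ, (k : ℝ) * struveWeight ν t k := by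
  have ht0 : 0 < t := by linarith
  have hs0 := summable_struveWeight hν ht0
  have hs1 := summable_mul_struveWeight hν ht0
  have hsG := summable_quadratic_mul_struveWeight hν ht0
  -- The moment of `(k + 1/2) (k + ν + 1/2)` is at least `t² S₀`.
  have mG : t ^ 2 * ∑' k, struveWeight ν t k ≤
      ∑' k : ℕ, ((k : ℝ) + 1 / 2) * ((k : ℝ) + ν + 1 / 2) * struveWeight ν t k := by
    rw [hsG.tsum_eq_zero_add, ← tsum_mul_left]
    have e : ∀ k : ℕ, (((k + 1 : ℕ) : ℝ) + 1 / 2) * (((k + 1 : ℕ) : ℝ) + ν + 1 / 2) *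
        struveWeight ν t (k + 1) = t ^ 2 * struveWeight ν t k := by
      intro k
      rw [← struveWeight_succ hν]
      push_cast
      ring
    rw [tsum_congr e]
    have hw := struveWeight_pos hν ht0 0
    have : 0 ≤ (((0 : ℕ) : ℝ) + 1 / 2) * (((0 : ℕ) : ℝ) + ν + 1 / 2) * struveWeight ν t 0 := by
      positivity
    linarith
  -- The moment of `k (k + 1/2) (k + ν + 1/2)` equals `t² (S₁ + S₀)`.
  have e : ∀ k : ℕ, ((k + 1 : ℕ) : ℝ) * ((((k + 1 : ℕ) : ℝ) + 1 / 2) *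
      (((k + 1 : ℕ) : ℝ) + ν + 1 / 2) * struveWeight ν t (k + 1)) =
      t ^ 2 * ((k : ℝ) * struveWeight ν t k + struveWeight ν t k) := by
    intro k
    rw [show t ^ 2 * ((k : ℝ) * struveWeight ν t k + struveWeight ν t k) =
      ((k : ℝ) + 1) * (t ^ 2 * struveWeight ν t k) by ring, ← struveWeight_succ hν]
    push_cast
    ring
  have hsK : Summable fun k : ℕ =>
      (k : ℝ) * (((k : ℝ) + 1 / 2) * ((k : ℝ) + ν + 1 / 2) * struveWeight ν t k) := by
    rw [← summable_nat_add_iff 1]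
    exact ((hs1.add hs0).mul_left (t ^ 2)).congr fun k => (e k).symm
  have mK : ∑' k : ℕ,
      (k : ℝ) * (((k : ℝ) + 1 / 2) * ((k : ℝ) + ν + 1 / 2) * struveWeight ν t k) =
      t ^ 2 * (∑' k : ℕ, (k : ℝ) * struveWeight ν t k + ∑' k, struveWeight ν t k) := by
    rw [hsK.tsum_eq_zero_add, tsum_congr e, tsum_mul_left, hs1.tsum_add hs0]
    simp
  -- With `G = (k + 1/2) (k + ν + 1/2)`, the difference of the two sides is
  -- `k (k - t)² + (ν + 1) (k - t)² + (2ν + 1) k / 4` times the weight.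
  have key : ∀ k : ℕ,
      2 * t * (((k : ℝ) + 1 / 2) * ((k : ℝ) + ν + 1 / 2) * struveWeight ν t k) ≤
      (k : ℝ) * (((k : ℝ) + 1 / 2) * ((k : ℝ) + ν + 1 / 2) * struveWeight ν t k) +
      (t ^ 2 * ((k : ℝ) * struveWeight ν t k) +
        ((ν + 1) * t ^ 2 + (2 * ν + 1) / 2 * t) * struveWeight ν t k) := by
    intro k
    have hw := struveWeight_pos hν ht0 k
    have h : 0 ≤ ((k : ℝ) * (k - t) ^ 2 + (ν + 1) * ((k : ℝ) - t) ^ 2 +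
        (2 * ν + 1) / 4 * k) * struveWeight ν t k := by positivity
    linarith
  have h := (hsG.mul_left (2 * t)).tsum_le_tsum key
    (hsK.add ((hs1.mul_left _).add (hs0.mul_left _)))
  rw [hsK.tsum_add ((hs1.mul_left _).add (hs0.mul_left _)),
    (hs1.mul_left _).tsum_add (hs0.mul_left _), tsum_mul_left, tsum_mul_left, tsum_mul_left,
    mK] at h
  have hS0 := tsum_struveWeight_pos hν ht0
  set S₀ := ∑' k, struveWeight ν t k
  set S₁ := ∑' k : ℕ, (k : ℝ) * struveWeight ν t k
  have h2 := mul_le_mul_of_nonneg_left mG (by positivity : 0 ≤ 2 * t)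
  -- The linear term in `t` is absorbed into the quadratic one because `1 ≤ t`.
  have h3 : 0 ≤ (2 * ν + 1) / 2 * (t * (t - 1)) * S₀ := by
    have : 0 ≤ t - 1 := by linarith
    positivity
  refine le_of_mul_le_mul_left ?_ (by positivity : 0 < 2 * t ^ 2)
  linarith

end Weights

/-! ### The quotient of Struve functions -/

lemma struveL_eq {ν x : ℝ} (hx : 0 < x) :
    struveL ν x = (x / 2) ^ (ν + 1) * ∑' k, struveWeight ν (x / 2) k := by
  unfold struveL
  rw [← tsum_mul_left]
  refine tsum_congr fun k => ?_
  rw [struveWeight, ← mul_div_assoc,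
    show ν + 2 * (k : ℝ) + 1 = (ν + 1) + ((2 * k : ℕ) : ℝ) by push_cast; ring,
    Real.rpow_add (by positivity), Real.rpow_natCast]

lemma struveL_sub_one_eq {ν x : ℝ} (hν : 0 < ν) (hx : 0 < x) :
    struveL (ν - 1) x = (x / 2) ^ ν * ((ν + 1 / 2) * ∑' k, struveWeight ν (x / 2) k +
      ∑' k : ℕ, (k : ℝ) * struveWeight ν (x / 2) k) := by
  have ht : 0 < x / 2 := by positivity
  unfold struveL
  rw [← tsum_mul_left, ← ((summable_struveWeight hν ht).mul_left _).tsum_add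
    (summable_mul_struveWeight hν ht), ← tsum_mul_left]
  refine tsum_congr fun k => ?_
  have e : Real.Gamma ((k : ℝ) + ν + 3 / 2) =
      ((k : ℝ) + ν + 1 / 2) * Real.Gamma ((k : ℝ) + (ν - 1) + 3 / 2) := by
    rw [show (k : ℝ) + (ν - 1) + 3 / 2 = (k : ℝ) + ν + 1 / 2 by ring,
      ← Real.Gamma_add_one (by positivity)]
    congr 1
    ring
  have h1 : 0 < Real.Gamma ((k : ℝ) + 3 / 2) := Real.Gamma_pos_of_pos (by positivity)
  have h2 : 0 < Real.Gamma ((k : ℝ) + (ν - 1) + 3 / 2) :=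
    Real.Gamma_pos_of_pos (by have : (0 : ℝ) ≤ k := k.cast_nonneg; linarith)
  have h3 : 0 < (k : ℝ) + ν + 1 / 2 := by positivity
  rw [struveWeight, e, show ν - 1 + 2 * (k : ℝ) + 1 = ν + ((2 * k : ℕ) : ℝ) by push_cast; ring,
    Real.rpow_add ht, Real.rpow_natCast, ← add_mul,
    show ν + 1 / 2 + (k : ℝ) = (k : ℝ) + ν + 1 / 2 by ring]
  generalize Real.Gamma ((k : ℝ) + (ν - 1) + 3 / 2) = g at *
  field_simp

lemma struveL_div_struveL {ν x : ℝ} (hν : 0 < ν) (hx : 0 < x) :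
    struveL ν x / struveL (ν - 1) x =
      x * (∑' k, struveWeight ν (x / 2) k) /
        ((2 * ν + 1) * ∑' k, struveWeight ν (x / 2) k +
          2 * ∑' k : ℕ, (k : ℝ) * struveWeight ν (x / 2) k) := by
  have ht : 0 < x / 2 := by positivity
  have hS0 := tsum_struveWeight_pos hν ht
  have hS1 := tsum_mul_struveWeight_nonneg hν ht
  rw [struveL_eq hx, struveL_sub_one_eq hν hx, Real.rpow_add_one ht.ne']
  set S₀ := ∑' k, struveWeight ν (x / 2) k
  set S₁ := ∑' k : ℕ, (k : ℝ) * struveWeight ν (x / 2) k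
  have hp : 0 < (x / 2) ^ ν := Real.rpow_pos_of_pos ht ν
  have hd : 0 < (ν + 1 / 2) * S₀ + S₁ := by positivity
  have hd' : 0 < (2 * ν + 1) * S₀ + 2 * S₁ := by positivity
  rw [div_eq_div_iff (by positivity) hd'.ne']
  ring

lemma struveL_div_struveL_gt {ν x : ℝ} (hν : 0 < ν) (hx : 0 < x) :
    x / (2 * ν + 1 + x) < struveL ν x / struveL (ν - 1) x := by
  have ht : 0 < x / 2 := by positivity
  have hS0 := tsum_struveWeight_pos hν ht
  have hS1 := tsum_mul_struveWeight_nonneg hν ht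
  have h := tsum_mul_struveWeight_lt hν ht
  rw [struveL_div_struveL hν hx, div_lt_div_iff₀ (by positivity) (by positivity), mul_assoc]
  exact mul_lt_mul_of_pos_left (by linarith) hx

/-- An upper bound for the quotient of the two sides, from a lower bound for the mean of `k`. -/
lemma struveL_quotient_le {ν x c : ℝ} (hν : 0 < ν) (hx : 0 < x) (hc : 0 < 2 * ν + 1 + 2 * c)
    (h : c * ∑' k, struveWeight ν (x / 2) k ≤ ∑' k : ℕ, (k : ℝ) * struveWeight ν (x / 2) k) :
    (struveL ν x / struveL (ν - 1) x) / (x / (2 * ν + 1 + x)) ≤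
      (2 * ν + 1 + x) / (2 * ν + 1 + 2 * c) := by
  have ht : 0 < x / 2 := by positivity
  have hS0 := tsum_struveWeight_pos hν ht
  have hS1 := tsum_mul_struveWeight_nonneg hν ht
  have hle : struveL ν x / struveL (ν - 1) x ≤ x / (2 * ν + 1 + 2 * c) := by
    rw [struveL_div_struveL hν hx, div_le_div_iff₀ (by positivity) hc, mul_assoc]
    exact mul_le_mul_of_nonneg_left (by linarith) hx.le
  rw [div_le_iff₀ (by positivity)]
  refine hle.trans_eq ?_
  have : 0 < 2 * ν + 1 + x := by positivity
  field_simp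

theorem lemma1 (ν : ℝ) (hν : 0 < ν) :
    (∀ x : ℝ, 0 < x → struveL ν x / struveL (ν - 1) x > x / (2 * ν + 1 + x)) ∧
    Tendsto (fun x : ℝ => (struveL ν x / struveL (ν - 1) x) / (x / (2 * ν + 1 + x)))
      (𝓝[>] 0) (𝓝 1) ∧
    Tendsto (fun x : ℝ => (struveL ν x / struveL (ν - 1) x) / (x / (2 * ν + 1 + x)))
      atTop (𝓝 1) := by
  have hlow : ∀ x : ℝ, 0 < x →
      1 ≤ (struveL ν x / struveL (ν - 1) x) / (x / (2 * ν + 1 + x)) := fun x hx =>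
    (one_le_div (by positivity)).mpr (struveL_div_struveL_gt hν hx).le
  refine ⟨fun x hx => struveL_div_struveL_gt hν hx, ?_, ?_⟩
  · have hlim : Tendsto (fun x : ℝ => (2 * ν + 1 + x) / (2 * ν + 1 + 2 * 0)) (𝓝[>] 0) (𝓝 1) := by
      have hc : Continuous fun x : ℝ => (2 * ν + 1 + x) / (2 * ν + 1 + 2 * 0) := by fun_prop
      have h := (hc.tendsto 0).mono_left (nhdsWithin_le_nhds (s := Set.Ioi 0))
      have e : (2 * ν + 1 + 0) / (2 * ν + 1 + 2 * 0) = 1 := by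
        rw [mul_zero, div_self (by positivity)]
      rwa [e] at h
    refine tendsto_of_tendsto_of_tendsto_of_le_of_le' tendsto_const_nhds hlim ?_ ?_
    · filter_upwards [self_mem_nhdsWithin] with x hx using hlow x hx
    · filter_upwards [self_mem_nhdsWithin] with x hx
      have hx : 0 < x := hx
      refine struveL_quotient_le hν hx (by positivity) ?_
      rw [zero_mul]
      exact tsum_mul_struveWeight_nonneg hν (by positivity)
  · have hlim : Tendsto (fun x : ℝ => (2 * ν + 1 + x) / (2 * ν + 1 + 2 * (x / 2 - ν - 5 / 4)))
        atTop (𝓝 1) := by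
      have h0 : Tendsto (fun x : ℝ => 1 + (2 * ν + 5 / 2) / (x - 3 / 2)) atTop (𝓝 (1 + 0)) :=
        tendsto_const_nhds.add
          (tendsto_const_nhds.div_atTop (tendsto_atTop_add_const_right _ _ tendsto_id))
      rw [add_zero] at h0
      refine h0.congr' ?_
      filter_upwards [eventually_gt_atTop (3 / 2)] with x hx
      have hx' : x - 3 / 2 ≠ 0 := by linarith
      rw [show 2 * ν + 1 + 2 * (x / 2 - ν - 5 / 4) = x - 3 / 2 by ring,
        one_add_div hx']
      congr 1
      ring
    refine tendsto_of_tendsto_of_tendsto_of_le_of_le' tendsto_const_nhds hlim ?_ ?_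
    · filter_upwards [eventually_gt_atTop 0] with x hx using hlow x hx
    · filter_upwards [eventually_ge_atTop 2] with x hx
      exact struveL_quotient_le hν (by linarith) (by linarith)
        (le_tsum_mul_struveWeight hν (by linarith))
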